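/- Let $G$ be a finite multigraph, and let $L(G)$ be its line graph: the simple graph whose vertices are the edges of $G$, two distinct edges being adjacent if they have a common end (in particular, parallel edges are adjacent). Let $\chi$ and $\omega$ denote the chromatic number and the clique number. Let $\ell, s, t$ be integers with $\ell \ge 0$ and $\tfrac{7}{2}\ell + 2 \le s \le t$. If $$\chi(L(G)) = s+t-1 > \omega(L(G)),$$ then $L(G)$ contains a clique $Q$ of size $s$ such that $$\chi(L(G) - Q) \ge t + \ell,$$ where $L(G)-Q$ is the graph obtained from $L(G)$ by deleting the vertices of $Q$. -/

import Mathlib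

/-- The line graph of a multigraph `G`: its vertices are the edges of `G`, and two distinct edges
are adjacent if they have a common end (so parallel edges are adjacent). -/
def Graph.lineGraph {α β : Type*} (G : Graph α β) : SimpleGraph G.edgeSet where
  Adj e f := e ≠ f ∧ ∃ x : α, G.Inc e x ∧ G.Inc f x
  symm := ⟨fun _ _ h => ⟨h.1.symm, h.2.imp fun _ hx => ⟨hx.2, hx.1⟩⟩⟩
  loopless := ⟨fun _ h => h.1 rfl⟩

/-!
Let `m = s + t - 2`, and let `F` be a minimal set of edges that is not `m`-colourable. Suppose that
deleting any clique of `s` edges from `F` leaves a `d`-colourable set, where `d = t + l - 1`. Then `F`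
has no loops, its cliques have at most `m` edges, and `d + (s - l - 1) = m`. So if `Q` consists of
`s` edges at a vertex `x`, one can colour `F \ Q` with `d` colours, leave `l + 1` edges of `Q`
uncoloured, and give each of the other `s - l - 1` edges of `Q` a new colour of its own.

Such singleton colour classes make recolouring easy (`IsColoring.exists_extend`): if `xy` is
uncoloured, `xz` is alone in its colour class `c`, and `α` is a colour missing at `x` that is not used
between `y` and `z`, then `xz` can get colour `α`, and both `xy` and the edge of colour `α` at `z` can
get colour `c`. This costs one singleton class and colours one more edge. If it can be done `l + 1`
times, then `F` is `m`-colourable, a contradiction. It can be done if the edges at `x` contain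
`l + 1` suitable disjoint groups (`IsStarFamily.colorable`), in particular groups of three pairwise
nonparallel edges, because `α` cannot be used both between `y` and `z` and between `y` and `w`.

For `s ≥ 3 l + 3` it follows that at a vertex `x` of degree at least `s` all but `2 l + 1` edges go to
a single vertex (`IsCritical.exists_dominant`). If two vertices are joined to `x` by more than `l`
edges each, suitable groups exist because a triangle spans at most `m` edges. Degree counts then show
that only two vertices have degree at least `s` and that they meet all edges
(`IsCritical.exists_cover`). A set of edges met by two vertices is easily coloured
(`IsCritical.false_of_three_mul_le`).

The hypothesis `7 l / 2 + 2 ≤ s` implies `3 l + 3 ≤ s` unless `l = 0` and `s = 2`. In that case, with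
`xy` and `xz` uncoloured, some colour `α` missing at `x` is used between `y` and `z`, and some colour
`β` is not used on the triangle `xyz`. Uncolouring the edge of colour `α` makes `α` missing at all
three vertices. One of them is separated from the other two in the graph of the edges of colours
`α` and `β` (`IsColoring.kempe_separated`), and a Kempe change there, followed by the same
recolouring, completes the colouring (`IsCritical.false_of_colorable_sdiff_pair`).
-/

namespace EdgeColoring

open Finset

set_option linter.unusedSectionVars false

/-! ### Edge colourings of multigraphs -/

variable {V E : Type*} [DecidableEq V] [DecidableEq E]

/-- The edges of `F` at the vertex `x`. A multigraph is given by the map `ends` that sends an edge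
to the unordered pair of its ends. -/
def star (ends : E → Sym2 V) (F : Finset E) (x : V) : Finset E :=
  F.filter fun e => x ∈ ends e

/-- The edges of `F` that join `x` and `y`. -/
def between (ends : E → Sym2 V) (F : Finset E) (x y : V) : Finset E :=
  F.filter fun e => ends e = s(x, y)

/-- The edges of `F` at `x` that do not have `y` as an end. -/
def away (ends : E → Sym2 V) (F : Finset E) (x y : V) : Finset E :=
  F.filter fun e => x ∈ ends e ∧ y ∉ ends e

/-- The edges in `Q` pairwise have a common end, that is, `Q` is a clique of the line graph. -/
def IsEdgeClique (ends : E → Sym2 V) (Q : Finset E) : Prop :=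
  ∀ e ∈ Q, ∀ f ∈ Q, ∃ v, v ∈ ends e ∧ v ∈ ends f

/-- `φ` is a proper edge colouring of `A` with the colours `0, …, m - 1`. Its values outside `A` are
irrelevant. -/
structure IsColoring (ends : E → Sym2 V) (A : Finset E) (m : ℕ) (φ : E → ℕ) : Prop where
  lt : ∀ e ∈ A, φ e < m
  ne : ∀ e ∈ A, ∀ f ∈ A, e ≠ f → ∀ v, v ∈ ends e → v ∈ ends f → φ e ≠ φ f

/-- The edge set `A` has a proper edge colouring with `m` colours. -/
def Colorable (ends : E → Sym2 V) (A : Finset E) (m : ℕ) : Prop :=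
  ∃ φ, IsColoring ends A m φ

/-- The colours below `m` that do not occur at `x` on edges of `A`. -/
def missing (ends : E → Sym2 V) (A : Finset E) (m : ℕ) (φ : E → ℕ) (x : V) : Finset ℕ :=
  (range m).filter fun c => ∀ e ∈ A, x ∈ ends e → φ e ≠ c

variable {ends : E → Sym2 V} {A F : Finset E} {m : ℕ} {φ : E → ℕ} {x y z : V} {e f : E}

@[simp] lemma mem_star : e ∈ star ends F x ↔ e ∈ F ∧ x ∈ ends e := by simp [star]

@[simp] lemma mem_between : e ∈ between ends F x y ↔ e ∈ F ∧ ends e = s(x, y) := by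
  simp [between]

@[simp] lemma mem_away : e ∈ away ends F x y ↔ e ∈ F ∧ x ∈ ends e ∧ y ∉ ends e := by
  simp [away]

@[simp] lemma mem_missing {c : ℕ} :
    c ∈ missing ends A m φ x ↔ c < m ∧ ∀ e ∈ A, x ∈ ends e → φ e ≠ c := by simp [missing]

lemma star_subset : star ends F x ⊆ F := filter_subset _ _

lemma between_comm : between ends F x y = between ends F y x := by
  ext e; simp [Sym2.eq_swap]

lemma isEdgeClique_of_mem {Q : Finset E} (h : ∀ e ∈ Q, x ∈ ends e) : IsEdgeClique ends Q :=
  fun e he f hf => ⟨x, h e he, h f hf⟩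

lemma isEdgeClique_of_triangle {Q : Finset E}
    (h : ∀ e ∈ Q, ends e = s(y, z) ∨ ends e = s(x, y) ∨ ends e = s(x, z)) :
    IsEdgeClique ends Q := by
  intro e he f hf
  rcases h e he with h1 | h1 | h1 <;> rcases h f hf with h2 | h2 | h2 <;> rw [h1, h2]
  · exact ⟨y, by simp⟩
  · exact ⟨y, by simp⟩
  · exact ⟨z, by simp⟩
  · exact ⟨y, by simp⟩
  · exact ⟨x, by simp⟩
  · exact ⟨x, by simp⟩
  · exact ⟨z, by simp⟩
  · exact ⟨x, by simp⟩
  · exact ⟨x, by simp⟩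

lemma IsColoring.mono {B : Finset E} (h : IsColoring ends A m φ) (hB : B ⊆ A) :
    IsColoring ends B m φ :=
  ⟨fun e he => h.lt e (hB he), fun e he f hf => h.ne e (hB he) f (hB hf)⟩

lemma IsColoring.mono_right {n : ℕ} (h : IsColoring ends A m φ) (hn : m ≤ n) :
    IsColoring ends A n φ :=
  ⟨fun e he => (h.lt e he).trans_le hn, h.ne⟩

/-- Colouring or recolouring a single edge. -/
lemma IsColoring.update (h : IsColoring ends A m φ) {c : ℕ} (hc : c < m)
    (hfree : ∀ f ∈ A, f ≠ e → ∀ v, v ∈ ends e → v ∈ ends f → φ f ≠ c) :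
    IsColoring ends (insert e A) m (Function.update φ e c) := by
  have hA : ∀ f ∈ insert e A, f ≠ e → f ∈ A := fun f hf hne => (mem_insert.1 hf).resolve_left hne
  refine ⟨fun f hf => ?_, fun f hf g hg hfg v hvf hvg => ?_⟩
  · by_cases hfe : f = e
    · simpa [hfe] using hc
    · simpa [hfe] using h.lt f (hA f hf hfe)
  · by_cases hfe : f = e
    · subst hfe
      have hgf : g ≠ f := hfg.symm
      simpa [hgf] using (hfree g (hA g hg hgf) hgf v hvf hvg).symm
    · by_cases hge : g = e
      · subst hge
        simpa [hfe] using hfree f (hA f hf hfe) hfe v hvg hvf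
      · simpa [hfe, hge] using h.ne f (hA f hf hfe) g (hA g hg hge) hfg v hvf hvg

lemma IsColoring.card_clique_le (h : IsColoring ends A m φ) {Q : Finset E} (hQA : Q ⊆ A)
    (hQ : IsEdgeClique ends Q) : #Q ≤ m := by
  rw [← card_range m]
  refine card_le_card_of_injOn φ (fun e he => by simpa using h.lt e (hQA he)) ?_
  intro e he f hf hef
  by_contra hne
  obtain ⟨v, hv, hv'⟩ := hQ e he f hf
  exact h.ne e (hQA he) f (hQA hf) hne v hv hv' hef

lemma le_card_missing_add : m ≤ #(missing ends A m φ x) + #(star ends A x) := by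
  have hsub : range m ⊆ missing ends A m φ x ∪ (star ends A x).image φ := by
    intro c hc
    by_cases hcm : c ∈ missing ends A m φ x
    · exact mem_union_left _ hcm
    · refine mem_union_right _ ?_
      simp only [mem_missing, not_and, not_forall] at hcm
      obtain ⟨e, he, hx, hec⟩ := hcm (mem_range.1 hc)
      exact mem_image.2 ⟨e, by simp [he, hx], not_not.1 hec⟩
  calc m = #(range m) := (card_range m).symm
    _ ≤ _ := card_le_card hsub
    _ ≤ _ := (card_union_le _ _).trans (Nat.add_le_add_left card_image_le _)

lemma ends_eq (hxy : x ≠ y) (hx : x ∈ ends e) (hy : y ∈ ends e) : ends e = s(x, y) :=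
  (Sym2.mem_and_mem_iff hxy).1 ⟨hx, hy⟩

lemma card_star_eq_add (hxy : x ≠ y) :
    #(star ends F x) = #(between ends F x y) + #(away ends F x y) := by
  rw [← card_union_of_disjoint]
  · congr 1
    ext g
    simp only [mem_star, mem_union, mem_between, mem_away]
    constructor
    · rintro ⟨hg, hx⟩
      by_cases hy : y ∈ ends g
      · exact Or.inl ⟨hg, ends_eq hxy hx hy⟩
      · exact Or.inr ⟨hg, hx, hy⟩
    · rintro (⟨hg, hx⟩ | ⟨hg, hx, -⟩)
      · exact ⟨hg, by simp [hx]⟩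
      · exact ⟨hg, hx⟩
  · rw [disjoint_left]
    intro g hg hg'
    rw [mem_between] at hg
    rw [mem_away, hg.2] at hg'
    simp at hg'

/-- `F` needs more than `m` colours, but each proper subset of `F` can do with `m`, and no clique of
the line graph on `F` has more than `m` elements. -/
structure IsCritical (ends : E → Sym2 V) (F : Finset E) (m : ℕ) : Prop where
  not_colorable : ¬ Colorable ends F m
  colorable_erase : ∀ e ∈ F, Colorable ends (F.erase e) m
  clique_le : ∀ Q ⊆ F, IsEdgeClique ends Q → #Q ≤ m

namespace IsCritical

lemma card_star_le (h : IsCritical ends F m) (x : V) : #(star ends F x) ≤ m :=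
  h.clique_le _ star_subset (isEdgeClique_of_mem fun _ he => (mem_star.1 he).2)

/-- The line-graph neighbours of a loop all lie in one star, so a loop is never critical. -/
lemma ends_ne (h : IsCritical ends F m) (he : e ∈ F) (hxy : ends e = s(x, y)) : x ≠ y := by
  rintro rfl
  obtain ⟨φ, hφ⟩ := h.colorable_erase e he
  have h1 := le_card_missing_add (ends := ends) (A := F.erase e) (m := m) (φ := φ) (x := x)
  have h2 : star ends (F.erase e) x = (star ends F x).erase e := by
    ext g; simp [and_assoc]
  have h3 := h.card_star_le x
  have h4 : e ∈ star ends F x := by simp [he, hxy]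
  have h5 := card_pos.2 ⟨e, h4⟩
  rw [h2, card_erase_of_mem h4] at h1
  obtain ⟨c, hc⟩ := card_pos.1 (by omega : 0 < #(missing ends (F.erase e) m φ x))
  rw [mem_missing] at hc
  refine h.not_colorable ⟨_, insert_erase he ▸ hφ.update hc.1 fun f hf _ v hv hvf => ?_⟩
  rw [hxy] at hv
  have : v = x := by simpa using hv
  exact hc.2 f hf (this ▸ hvf)

/-- No colour is missing at both ends of the only uncoloured edge. -/
lemma not_missing_both (h : IsCritical ends F m) (he : e ∈ F) (hxy : ends e = s(x, y))
    (hφ : IsColoring ends (F.erase e) m φ) {c : ℕ} (hx : c ∈ missing ends (F.erase e) m φ x)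
    (hy : c ∈ missing ends (F.erase e) m φ y) : False := by
  rw [mem_missing] at hx hy
  refine h.not_colorable ⟨_, insert_erase he ▸ hφ.update hx.1 fun f hf _ v hv hvf => ?_⟩
  rw [hxy, Sym2.mem_iff] at hv
  rcases hv with rfl | rfl
  · exact hx.2 f hf hvf
  · exact hy.2 f hf hvf

/-- When `xy` is the only uncoloured edge, each colour missing at `y` occurs at `x`, on an edge
that avoids `y`. -/
lemma lt_card_star_add_away (h : IsCritical ends F m) (he : e ∈ F) (hxy : ends e = s(x, y)) :
    m + 1 ≤ #(star ends F y) + #(away ends F x y) := by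
  obtain ⟨φ, hφ⟩ := h.colorable_erase e he
  have h1 := le_card_missing_add (ends := ends) (A := F.erase e) (m := m) (φ := φ) (x := y)
  have h2 : star ends (F.erase e) y = (star ends F y).erase e := by
    ext g; simp [and_assoc]
  have h4 : e ∈ star ends F y := by simp [he, hxy]
  have h5 := card_pos.2 ⟨e, h4⟩
  rw [h2, card_erase_of_mem h4] at h1
  have h6 : missing ends (F.erase e) m φ y ⊆ (away ends F x y).image φ := by
    intro c hc
    by_contra hcon
    refine h.not_missing_both he hxy hφ (mem_missing.2 ⟨(mem_missing.1 hc).1, ?_⟩) hc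
    intro g hg hxg hgc
    refine hcon (mem_image.2 ⟨g, ?_, hgc⟩)
    exact mem_away.2 ⟨mem_of_mem_erase hg, hxg, fun hyg => (mem_missing.1 hc).2 g hg hyg hgc⟩
  have h7 := (card_le_card h6).trans card_image_le
  omega

end IsCritical

/-- The basic recolouring. Let `e = xy` be uncoloured, let `f = xz` be the only edge of its colour
`c`, and let `α` be a colour missing at `x` that is not used between `y` and `z`. Giving `α` to
`f`, and `c` to `e` and to the edge of colour `α` at `z` (if there is one), colours `e` too. No
other edge at `x` changes, and those that were alone in their colour class remain so. -/
lemma IsColoring.exists_extend (h : IsColoring ends A m φ) (heA : e ∉ A) (hfA : f ∈ A)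
    (he : ends e = s(x, y)) (hf : ends f = s(x, z)) (hyz : y ≠ z) (hxy : x ≠ y) (hxz : x ≠ z)
    (hfu : ∀ g ∈ A, φ g = φ f → g = f) {α : ℕ} (hα : α ∈ missing ends A m φ x)
    (hαyz : ∀ g ∈ A, ends g = s(y, z) → φ g ≠ α) :
    ∃ ψ, IsColoring ends (insert e A) m ψ ∧ ∀ g ∈ A, x ∈ ends g → g ≠ f →
      (∀ k ∈ A, φ k = φ g → k = g) → ∀ k ∈ insert e A, ψ k = ψ g → k = g := by
  rw [mem_missing] at hα
  obtain ⟨hαm, hα⟩ := hα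
  have hαf : φ f ≠ α := hα f hfA (by simp [hf])
  have hef : e ≠ f := fun h => heA (h ▸ hfA)
  by_cases hz : ∃ k ∈ A, z ∈ ends k ∧ φ k = α
  · obtain ⟨k, hkA, hzk, hkα⟩ := hz
    have hxk : x ∉ ends k := fun hx => hα k hkA hx hkα
    have hyk : y ∉ ends k := fun hy => hαyz k hkA (ends_eq hyz hy hzk) hkα
    have hkf : k ≠ f := by rintro rfl; exact hxk (by simp [hf])
    have hke : k ≠ e := fun h => heA (h ▸ hkA)
    have h1 := (h.mono (erase_subset f A)).update (e := k) (h.lt f hfA)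
      (fun g hg _ v _ _ hgc => (mem_erase.1 hg).1 (hfu g (mem_erase.1 hg).2 hgc))
    rw [insert_eq_of_mem (mem_erase.2 ⟨hkf, hkA⟩)] at h1
    have h2 := h1.update (e := f) hαm (by
      intro g hg hgf v hvf hvg
      by_cases hgk : g = k
      · simpa [hgk] using hαf
      · simp only [Function.update_of_ne hgk]
        rw [hf, Sym2.mem_iff] at hvf
        rcases hvf with rfl | rfl
        · exact hα g (mem_erase.1 hg).2 hvg
        · rw [← hkα]; exact h.ne g (mem_erase.1 hg).2 k hkA hgk v hvg hzk)
    rw [insert_erase hfA] at h2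
    have h3 := h2.update (e := e) (h.lt f hfA) (by
      intro g hg hge v hve hvg
      by_cases hgf : g = f
      · simpa [hgf] using hαf.symm
      · by_cases hgk : g = k
        · subst hgk
          rw [he, Sym2.mem_iff] at hve
          rcases hve with rfl | rfl
          · exact absurd hvg hxk
          · exact absurd hvg hyk
        · simp only [Function.update_of_ne hgf, Function.update_of_ne hgk]
          exact fun hgc => hgf (hfu g hg hgc))
    refine ⟨_, h3, fun g hg hxg hgf hgu j hj hjg => ?_⟩
    have hge : g ≠ e := fun h => heA (h ▸ hg)
    have hgk : g ≠ k := fun h => hxk (h ▸ hxg)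
    have hgc : φ f ≠ φ g := fun h => hgf (hgu f hfA h).symm
    have hgα : α ≠ φ g := fun h => hα g hg hxg h.symm
    simp only [Function.update_of_ne hge, Function.update_of_ne hgf,
      Function.update_of_ne hgk] at hjg
    by_cases hje : j = e
    · subst hje; exact absurd (by simpa using hjg) hgc
    · rw [Function.update_of_ne hje] at hjg
      by_cases hjf : j = f
      · subst hjf; exact absurd (by simpa using hjg) hgα
      · rw [Function.update_of_ne hjf] at hjg
        by_cases hjk : j = k
        · subst hjk; exact absurd (by simpa using hjg) hgc
        · rw [Function.update_of_ne hjk] at hjg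
          exact hgu j ((mem_insert.1 hj).resolve_left hje) hjg
  · push Not at hz
    have h2 := h.update (e := f) hαm (by
      intro g hg hgf v hvf hvg
      rw [hf, Sym2.mem_iff] at hvf
      rcases hvf with rfl | rfl
      · exact hα g hg hvg
      · exact hz g hg hvg)
    rw [insert_eq_of_mem hfA] at h2
    have h3 := h2.update (e := e) (h.lt f hfA) (by
      intro g hg hge v hve hvg
      by_cases hgf : g = f
      · simpa [hgf] using hαf.symm
      · simp only [Function.update_of_ne hgf]
        exact fun hgc => hgf (hfu g hg hgc))
    refine ⟨_, h3, fun g hg hxg hgf hgu j hj hjg => ?_⟩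
    have hge : g ≠ e := fun h => heA (h ▸ hg)
    have hgc : φ f ≠ φ g := fun h => hgf (hgu f hfA h).symm
    have hgα : α ≠ φ g := fun h => hα g hg hxg h.symm
    simp only [Function.update_of_ne hge, Function.update_of_ne hgf] at hjg
    by_cases hje : j = e
    · subst hje; exact absurd (by simpa using hjg) hgc
    · rw [Function.update_of_ne hje] at hjg
      by_cases hjf : j = f
      · subst hjf; exact absurd (by simpa using hjg) hgα
      · rw [Function.update_of_ne hjf] at hjg
        exact hgu j ((mem_insert.1 hj).resolve_left hje) hjg

/-! ### Colouring several edges at a vertex -/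

/-- Disjoint groups `{e i, f i, g i}`, `i < n`, of edges at `x`, with other ends `y, z, w`, each
of which allows `IsColoring.exists_extend` to colour `e i` while `e 0, …, e i` are uncoloured. If
`z ≠ w`, a colour missing at `x` cannot be used both between `y` and `z` and between `y` and `w`.
Otherwise (usually with `f i = g i`), more colours are missing at `x` than there are edges between
`y` and `z`. -/
structure IsStarFamily (ends : E → Sym2 V) (F : Finset E) (m : ℕ) (x : V) (n : ℕ)
    (e f g : ℕ → E) : Prop where
  e_mem : ∀ i < n, e i ∈ star ends F x
  f_mem : ∀ i < n, f i ∈ star ends F x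
  g_mem : ∀ i < n, g i ∈ star ends F x
  e_inj : ∀ i < n, ∀ j < n, e i = e j → i = j
  e_ne_f : ∀ i < n, ∀ j < n, e i ≠ f j
  e_ne_g : ∀ i < n, ∀ j < n, e i ≠ g j
  f_inj : ∀ i < n, ∀ j < n, f i = f j → i = j
  g_inj : ∀ i < n, ∀ j < n, g i = g j → i = j
  f_ne_g : ∀ i < n, ∀ j < n, i ≠ j → f i ≠ g j
  valid : ∀ i < n, ∃ y z w, ends (e i) = s(x, y) ∧ ends (f i) = s(x, z) ∧ ends (g i) = s(x, w) ∧
    y ≠ z ∧ y ≠ w ∧ (z ≠ w ∨ #(between ends F y z) + #(star ends F x) < m + i + 1)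

lemma IsStarFamily.of_succ {n : ℕ} {e f g : ℕ → E}
    (h : IsStarFamily ends F m x (n + 1) e f g) : IsStarFamily ends F m x n e f g where
  e_mem i hi := h.e_mem i (by omega)
  f_mem i hi := h.f_mem i (by omega)
  g_mem i hi := h.g_mem i (by omega)
  e_inj i hi j hj := h.e_inj i (by omega) j (by omega)
  e_ne_f i hi j hj := h.e_ne_f i (by omega) j (by omega)
  e_ne_g i hi j hj := h.e_ne_g i (by omega) j (by omega)
  f_inj i hi j hj := h.f_inj i (by omega) j (by omega)
  g_inj i hi j hj := h.g_inj i (by omega) j (by omega)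
  f_ne_g i hi j hj := h.f_ne_g i (by omega) j (by omega)
  valid i hi := h.valid i (by omega)

/-- The edges `e i` get coloured in order of decreasing `i`. -/
lemma IsStarFamily.colorable (hloop : ∀ e ∈ F, ∀ u v, ends e = s(u, v) → u ≠ v)
    (hdeg : #(star ends F x) ≤ m) {n : ℕ} {e f g : ℕ → E}
    (h : IsStarFamily ends F m x n e f g) (hφ : IsColoring ends (F \ (range n).image e) m φ)
    (hf : ∀ i < n, ∀ k ∈ F \ (range n).image e, φ k = φ (f i) → k = f i)
    (hg : ∀ i < n, ∀ k ∈ F \ (range n).image e, φ k = φ (g i) → k = g i) :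
    Colorable ends F m := by
  induction n generalizing φ with
  | zero => exact ⟨φ, by simpa using hφ⟩
  | succ n ih =>
    have hlt : n < n + 1 := Nat.lt_succ_self n
    set A := F \ (range (n + 1)).image e with hA
    have hfA : ∀ i < n + 1, f i ∈ A := fun i hi => by
      rw [hA, mem_sdiff, mem_image]
      refine ⟨(mem_star.1 (h.f_mem i hi)).1, ?_⟩
      rintro ⟨j, hj, hji⟩
      exact h.e_ne_f j (mem_range.1 hj) i hi hji
    have hgA : ∀ i < n + 1, g i ∈ A := fun i hi => by
      rw [hA, mem_sdiff, mem_image]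
      refine ⟨(mem_star.1 (h.g_mem i hi)).1, ?_⟩
      rintro ⟨j, hj, hji⟩
      exact h.e_ne_g j (mem_range.1 hj) i hi hji
    have heA : e n ∉ A := by
      rw [hA, mem_sdiff, not_and, not_not]
      exact fun _ => mem_image_of_mem _ (mem_range.2 hlt)
    have heF : e n ∈ F := (mem_star.1 (h.e_mem n hlt)).1
    have hins : insert (e n) A = F \ (range n).image e := by
      ext k
      simp only [hA, mem_insert, mem_sdiff, range_add_one, image_insert, not_or]
      constructor
      · rintro (rfl | ⟨hk, -, hk'⟩)
        · refine ⟨heF, fun hc => ?_⟩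
          obtain ⟨j, hj, hjn⟩ := mem_image.1 hc
          have hj' := mem_range.1 hj
          have := h.e_inj j (by omega) n hlt hjn
          omega
        · exact ⟨hk, hk'⟩
      · rintro ⟨hk, hk'⟩
        by_cases hke : k = e n
        · exact Or.inl hke
        · exact Or.inr ⟨hk, hke, hk'⟩
    have hstarA : #(star ends A x) + (n + 1) ≤ #(star ends F x) := by
      have h1 : #((range (n + 1)).image e) = n + 1 := by
        rw [card_image_of_injOn, card_range]
        intro i hi j hj hij
        exact h.e_inj i (by simpa using hi) j (by simpa using hj) hij
      rw [← h1, ← card_union_of_disjoint]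
      · refine card_le_card (union_subset ?_ ?_)
        · intro k hk
          rw [mem_star] at hk ⊢
          exact ⟨(mem_sdiff.1 hk.1).1, hk.2⟩
        · intro k hk
          obtain ⟨j, hj, rfl⟩ := mem_image.1 hk
          exact h.e_mem j (mem_range.1 hj)
      · rw [disjoint_left]
        intro k hk
        exact (mem_sdiff.1 (mem_star.1 hk).1).2
    have hmiss := le_card_missing_add (ends := ends) (A := A) (m := m) (φ := φ) (x := x)
    -- `p` stands for whichever of `f n` and `g n` admits the recolouring.
    have key : ∀ p v y, p ∈ A → ends (e n) = s(x, y) → ends p = s(x, v) → y ≠ v →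
        (∀ k ∈ A, φ k = φ p → k = p) → (∀ i < n, p ≠ f i ∧ p ≠ g i) →
        (∃ α ∈ missing ends A m φ x, ∀ k ∈ A, ends k = s(y, v) → φ k ≠ α) →
        Colorable ends F m := by
      rintro p v y hpA he hp hyv hpu hpne ⟨α, hα, hαyv⟩
      obtain ⟨ψ, hψ, hψu⟩ := hφ.exists_extend heA hpA he hp hyv (hloop _ heF _ _ he)
        (hloop _ (mem_sdiff.1 hpA).1 _ _ hp) hpu hα hαyv
      rw [hins] at hψ hψu
      refine ih h.of_succ hψ (fun i hi => ?_) (fun i hi => ?_)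
      · exact hψu _ (hfA i (by omega)) (mem_star.1 (h.f_mem i (by omega))).2 (hpne i hi).1.symm
          (hf i (by omega))
      · exact hψu _ (hgA i (by omega)) (mem_star.1 (h.g_mem i (by omega))).2 (hpne i hi).2.symm
          (hg i (by omega))
    have hfne : ∀ i < n, f n ≠ f i ∧ f n ≠ g i := fun i hi =>
      ⟨fun hc => by have := h.f_inj n hlt i (by omega) hc; omega,
        h.f_ne_g n hlt i (by omega) (by omega)⟩
    have hgne : ∀ i < n, g n ≠ f i ∧ g n ≠ g i := fun i hi =>
      ⟨(h.f_ne_g i (by omega) n hlt (by omega)).symm,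
        fun hc => by have := h.g_inj n hlt i (by omega) hc; omega⟩
    obtain ⟨y, z, w, hy, hz, hw, hyz, hyw, hor⟩ := h.valid n hlt
    rcases hor with hzw | hcard
    · obtain ⟨α, hα⟩ := card_pos.1 (by omega : 0 < #(missing ends A m φ x))
      by_cases hαz : ∀ k ∈ A, ends k = s(y, z) → φ k ≠ α
      · exact key (f n) z y (hfA n hlt) hy hz hyz (hf n hlt) hfne ⟨α, hα, hαz⟩
      · push Not at hαz
        obtain ⟨k, hk, hkyz, hkα⟩ := hαz
        refine key (g n) w y (hgA n hlt) hy hw hyw (hg n hlt) hgne ⟨α, hα, ?_⟩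
        intro j hj hjyw hjα
        have hkj : k ≠ j := by
          rintro rfl
          rw [hkyz, Sym2.congr_right] at hjyw
          exact hzw hjyw
        exact hφ.ne k hk j hj hkj y (by simp [hkyz]) (by simp [hjyw]) (hkα.trans hjα.symm)
    · have hlt' : #((between ends F y z).image φ) < #(missing ends A m φ x) :=
        card_image_le.trans_lt (by omega)
      obtain ⟨α, hα, hα'⟩ := exists_mem_notMem_of_card_lt_card hlt'
      refine key (f n) z y (hfA n hlt) hy hz hyz (hf n hlt) hfne ⟨α, hα, fun k hk hkyz hkα => ?_⟩
      exact hα' (mem_image.2 ⟨k, mem_between.2 ⟨(mem_sdiff.1 hk).1, hkyz⟩, hkα⟩)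

/-- A colouring of `F \ Q` extends to `F \ U` by giving each edge of `Q \ U` a colour of its
own. -/
lemma IsColoring.exists_injective_extend {Q U : Finset E} {d : ℕ}
    (h : IsColoring ends (F \ Q) d φ) (hd : d + #(Q \ U) ≤ m) :
    ∃ ψ, IsColoring ends (F \ U) m ψ ∧ ∀ p ∈ Q \ U, ∀ k ∈ F \ U, ψ k = ψ p → k = p := by
  let ι := (Q \ U).equivFin
  let ψ : E → ℕ := fun k => if hk : k ∈ Q \ U then d + ι ⟨k, hk⟩ else φ k
  have hin : ∀ k (hk : k ∈ Q \ U), ψ k = d + ι ⟨k, hk⟩ := fun k hk => by simp only [ψ, dif_pos hk]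
  have hout : ∀ k, k ∉ Q \ U → ψ k = φ k := fun k hk => by simp only [ψ, dif_neg hk]
  have hmem : ∀ k ∈ F \ U, k ∉ Q \ U → k ∈ F \ Q := fun k hk hk' => by
    rw [mem_sdiff] at hk hk' ⊢
    exact ⟨hk.1, fun hq => hk' ⟨hq, hk.2⟩⟩
  have hu : ∀ p ∈ Q \ U, ∀ k ∈ F \ U, ψ k = ψ p → k = p := by
    intro p hp k hk hkp
    rw [hin p hp] at hkp
    by_cases hkQ : k ∈ Q \ U
    · rw [hin k hkQ] at hkp
      have : ι ⟨k, hkQ⟩ = ι ⟨p, hp⟩ := Fin.ext (by omega)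
      simpa using ι.injective this
    · rw [hout k hkQ] at hkp
      have := h.lt k (hmem k hk hkQ)
      omega
  refine ⟨ψ, ⟨fun k hk => ?_, fun k hk j hj hkj v hvk hvj hψ => ?_⟩, hu⟩
  · by_cases hkQ : k ∈ Q \ U
    · rw [hin k hkQ]
      have := (ι ⟨k, hkQ⟩).isLt
      omega
    · rw [hout k hkQ]
      have := h.lt k (hmem k hk hkQ)
      omega
  · by_cases hjQ : j ∈ Q \ U
    · exact hkj (hu j hjQ k hk hψ)
    · by_cases hkQ : k ∈ Q \ U
      · exact hkj (hu k hkQ j hj hψ.symm).symm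
      · rw [hout k hkQ, hout j hjQ] at hψ
        exact h.ne k (hmem k hk hkQ) j (hmem j hj hjQ) hkj v hvk hvj hψ

namespace IsCritical

variable {s d l : ℕ}

/-- There is no family of `l + 1` groups if the deletion of `s` edges at `x` saves at least
`s - l - 1` colours. -/
lemma false_of_isStarFamily (h : IsCritical ends F m) (hm : d + s ≤ m + l + 1)
    (hdel : ∀ Q ⊆ F, IsEdgeClique ends Q → #Q = s → Colorable ends (F \ Q) d)
    (hx : s ≤ #(star ends F x)) {e f g : ℕ → E}
    (hfam : IsStarFamily ends F m x (l + 1) e f g)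
    (hcard : #((range (l + 1)).image e ∪ ((range (l + 1)).image f ∪ (range (l + 1)).image g)) ≤ s) :
    False := by
  obtain ⟨Q, hQ1, hQ2, hQ3⟩ := exists_subsuperset_card_eq (t := star ends F x)
    (union_subset (image_subset_iff.2 fun i hi => hfam.e_mem i (mem_range.1 hi))
      (union_subset (image_subset_iff.2 fun i hi => hfam.f_mem i (mem_range.1 hi))
        (image_subset_iff.2 fun i hi => hfam.g_mem i (mem_range.1 hi)))) hcard hx
  obtain ⟨φ, hφ⟩ := hdel Q (hQ2.trans star_subset)
    (isEdgeClique_of_mem fun e he => (mem_star.1 (hQ2 he)).2) hQ3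
  have hU : (range (l + 1)).image e ⊆ Q := subset_union_left.trans hQ1
  have hUc : #((range (l + 1)).image e) = l + 1 := by
    rw [card_image_of_injOn, card_range]
    intro i hi j hj hij
    exact hfam.e_inj i (by simpa using hi) j (by simpa using hj) hij
  have hle := card_le_card hU
  obtain ⟨ψ, hψ, hψu⟩ := hφ.exists_injective_extend (m := m) (U := (range (l + 1)).image e) (by
    rw [card_sdiff_of_subset hU]; omega)
  refine h.not_colorable (hfam.colorable (fun e he u v => h.ends_ne he) (h.card_star_le x) hψ
    (fun i hi => hψu _ ?_) (fun i hi => hψu _ ?_))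
  · rw [mem_sdiff]
    refine ⟨hQ1 (mem_union_right _ (mem_union_left _ (mem_image_of_mem _ (mem_range.2 hi)))), ?_⟩
    rw [mem_image]
    rintro ⟨j, hj, hji⟩
    exact hfam.e_ne_f j (mem_range.1 hj) i hi hji
  · rw [mem_sdiff]
    refine ⟨hQ1 (mem_union_right _ (mem_union_right _ (mem_image_of_mem _ (mem_range.2 hi)))), ?_⟩
    rw [mem_image]
    rintro ⟨j, hj, hji⟩
    exact hfam.e_ne_g j (mem_range.1 hj) i hi hji

end IsCritical

/-! ### Deleting many edges at a vertex -/

lemma exists_enumeration [Nonempty E] (T : Finset E) :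
    ∃ r : ℕ → E, (∀ i < #T, r i ∈ T) ∧ ∀ i < #T, ∀ j < #T, r i = r j → i = j := by
  refine ⟨fun i => if hi : i < #T then T.equivFin.symm ⟨i, hi⟩ else Classical.arbitrary E,
    fun i hi => ?_, fun i hi j hj hij => ?_⟩
  · simp [hi]
  · simp only [dif_pos hi, dif_pos hj] at hij
    simpa using T.equivFin.symm.injective (Subtype.ext hij)

/-- If no class of `c` has more than `n` elements, then listing a set class by class puts elements
at distance at least `n` into distinct classes. -/
lemma exists_spread_enumeration [Nonempty E] {S : Finset E} {k n : ℕ} (c : E → V) (hS : #S = k)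
    (hc : ∀ v, #(S.filter fun e => c e = v) ≤ n) :
    ∃ a : ℕ → E, (∀ i < k, a i ∈ S) ∧ (∀ i < k, ∀ j < k, a i = a j → i = j) ∧
      ∀ i j, i + n ≤ j → j < k → c (a i) ≠ c (a j) := by
  let σ : Fin k ≃ S := (S.equivFinOfCardEq hS).symm
  let : LinearOrder V := IsWellOrder.linearOrder WellOrderingRel
  let b : Fin k → V := fun i => c (σ i)
  have hmono : Monotone (b ∘ Tuple.sort b) := Tuple.monotone_sort b
  let a : ℕ → E := fun i => if hi : i < k then σ (Tuple.sort b ⟨i, hi⟩) else Classical.arbitrary E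
  have ha : ∀ i (hi : i < k), a i = σ (Tuple.sort b ⟨i, hi⟩) := fun i hi => by
    simp only [a, dif_pos hi]
  have hmem : ∀ i < k, a i ∈ S := fun i hi => by rw [ha i hi]; exact (σ _).2
  have hinj : ∀ i < k, ∀ j < k, a i = a j → i = j := by
    intro i hi j hj hij
    rw [ha i hi, ha j hj] at hij
    simpa using (Tuple.sort b).injective (σ.injective (Subtype.ext hij))
  have hle : ∀ i j, i ≤ j → j < k → c (a i) ≤ c (a j) := by
    intro i j hij hj
    rw [ha i (by omega), ha j hj]
    exact hmono (show (⟨i, by omega⟩ : Fin k) ≤ ⟨j, hj⟩ from hij)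
  refine ⟨a, hmem, hinj, fun i j hij hj heq => ?_⟩
  have hcard : #((Icc i (i + n)).image a) = n + 1 := by
    rw [card_image_of_injOn, Nat.card_Icc]
    · omega
    · intro p hp q hq hpq
      simp only [coe_Icc, Set.mem_Icc] at hp hq
      exact hinj p (by omega) q (by omega) hpq
  have hsub : (Icc i (i + n)).image a ⊆ S.filter fun e => c e = c (a i) := by
    intro e he
    obtain ⟨p, hp, rfl⟩ := mem_image.1 he
    rw [mem_Icc] at hp
    refine mem_filter.2 ⟨hmem p (by omega), le_antisymm ?_ (hle i p hp.1 (by omega))⟩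
    rw [heq]
    exact hle p j (by omega) hj
  have := (card_le_card hsub).trans (hc (c (a i)))
  omega

namespace IsCritical

variable {s d l : ℕ}

/-- Deleting `s` edges at `x`, as many as possible of them away from `w`, leaves at most `d` edges
at `w`. -/
lemma card_star_add_away_le
    (hdel : ∀ Q ⊆ F, IsEdgeClique ends Q → #Q = s → Colorable ends (F \ Q) d)
    {w : V} (hx : s ≤ #(star ends F x)) (hw : d < #(star ends F w)) :
    #(star ends F w) + #(away ends F x w) ≤ d + s := by
  have hstar : ∀ Q ⊆ star ends F x, #Q = s → #(star ends F w \ Q) ≤ d := by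
    intro Q hQ hQs
    obtain ⟨φ, hφ⟩ := hdel Q (hQ.trans star_subset)
      (isEdgeClique_of_mem fun e he => (mem_star.1 (hQ he)).2) hQs
    exact hφ.card_clique_le (sdiff_subset_sdiff star_subset le_rfl)
      (isEdgeClique_of_mem (x := w) fun e he => (mem_star.1 (mem_sdiff.1 he).1).2)
  have haway : away ends F x w ⊆ star ends F x := fun e he => by
    rw [mem_away] at he
    exact mem_star.2 ⟨he.1, he.2.1⟩
  rcases le_total s #(away ends F x w) with hs | hs
  · obtain ⟨Q, hQ, hQs⟩ := exists_subset_card_eq hs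
    have h1 := hstar Q (hQ.trans haway) hQs
    rw [sdiff_eq_self_of_disjoint] at h1
    · omega
    · rw [disjoint_right]
      intro e he hew
      exact (mem_away.1 (hQ he)).2.2 (mem_star.1 hew).2
  · obtain ⟨Q, hQ1, hQ2, hQ3⟩ := exists_subsuperset_card_eq haway hs hx
    have h1 := hstar Q hQ2 hQ3
    have h2 := card_inter_add_card_sdiff (star ends F w) Q
    have h3 : #((star ends F w ∩ Q) ∪ away ends F x w) ≤ #Q :=
      card_le_card (union_subset inter_subset_right hQ1)
    rw [card_union_of_disjoint] at h3
    · omega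
    · rw [disjoint_left]
      intro e he hea
      exact (mem_away.1 hea).2.2 (mem_star.1 (mem_inter.1 he).1).2

/-- The edges on a triangle form a clique of the line graph. -/
lemma card_triangle_le (h : IsCritical ends F m) (hxy : x ≠ y) (hxz : x ≠ z) :
    #(between ends F y z) + #(star ends F x) ≤
      m + #(F.filter fun e => x ∈ ends e ∧ y ∉ ends e ∧ z ∉ ends e) := by
  set R := F.filter fun e => x ∈ ends e ∧ y ∉ ends e ∧ z ∉ ends e with hR
  have hT : ∀ e ∈ between ends F y z ∪ (star ends F x \ R),
      ends e = s(y, z) ∨ ends e = s(x, y) ∨ ends e = s(x, z) := by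
    intro e he
    rcases mem_union.1 he with he | he
    · exact Or.inl (mem_between.1 he).2
    · rw [mem_sdiff, mem_star, hR, mem_filter] at he
      obtain ⟨⟨heF, hx⟩, hn⟩ := he
      by_cases hy : y ∈ ends e
      · exact Or.inr (Or.inl (ends_eq hxy hx hy))
      · by_cases hz : z ∈ ends e
        · exact Or.inr (Or.inr (ends_eq hxz hx hz))
        · exact absurd ⟨heF, hx, hy, hz⟩ hn
  have h1 := h.clique_le (between ends F y z ∪ (star ends F x \ R)) (union_subset
    (filter_subset _ _) (sdiff_subset.trans star_subset)) (isEdgeClique_of_triangle hT)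
  rw [card_union_of_disjoint] at h1
  · have h2 : R ⊆ star ends F x := fun e he => by
      rw [hR, mem_filter] at he
      exact mem_star.2 ⟨he.1, he.2.1⟩
    have h3 := card_sdiff_add_card_eq_card h2
    omega
  · rw [disjoint_left]
    intro e he he'
    rw [mem_between] at he
    rw [mem_sdiff, mem_star, he.2] at he'
    simp [hxy, hxz] at he'

section Large

variable (h : IsCritical ends F m) (hm : d + s = m + l + 1)
  (hdel : ∀ Q ⊆ F, IsEdgeClique ends Q → #Q = s → Colorable ends (F \ Q) d) (hs : 3 * l + 3 ≤ s)
  (hsm : 2 * s ≤ m + 2)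

include h hm hdel hs

/-- A vertex of degree at least `s` is not joined to two vertices by more than `l` edges each.
Groups `{xy, xz}` are good as long as the number of uncoloured edges is large. The last groups
have to be supplemented by an edge from `x` to a fourth vertex, and as the triangle `xyz` is not
a large clique, there are enough of those. -/
lemma eq_of_lt_card_between (hx : s ≤ #(star ends F x)) (hy : l < #(between ends F x y))
    (hz : l < #(between ends F x z)) : y = z := by
  by_contra hyz
  obtain ⟨e₀, he₀⟩ := card_pos.1 (Nat.zero_lt_of_lt hy)
  obtain ⟨f₀, hf₀⟩ := card_pos.1 (Nat.zero_lt_of_lt hz)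
  rw [mem_between] at he₀ hf₀
  have hxy := h.ends_ne he₀.1 he₀.2
  have hxz := h.ends_ne hf₀.1 hf₀.2
  have htri := h.card_triangle_le hxy hxz
  set R := F.filter fun e => x ∈ ends e ∧ y ∉ ends e ∧ z ∉ ends e with hR
  have : Nonempty E := ⟨e₀⟩
  obtain ⟨e, he, hei⟩ := exists_enumeration (between ends F x y)
  obtain ⟨f, hf, hfi⟩ := exists_enumeration (between ends F x z)
  obtain ⟨r, hr, hri⟩ := exists_enumeration R
  simp only [mem_between] at he hf
  simp only [hR, mem_filter] at hr
  rw [← hR] at hr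
  let g : ℕ → E := fun i => if i < #R then r i else f i
  have hg : ∀ i, g i = if i < #R then r i else f i := fun i => rfl
  have hrf : ∀ i < #R, ∀ j < l + 1, r i ≠ f j := fun i hi j hj hij => by
    have h1 := (hr i hi).2.2.2
    rw [hij, (hf j (by omega)).2] at h1
    simp at h1
  refine h.false_of_isStarFamily hm.le hdel hx (e := e) (f := f) (g := g) ?_ ?_
  · refine ⟨fun i hi => ?_, fun i hi => ?_, fun i hi => ?_,
      fun i hi j hj => hei i (by omega) j (by omega), fun i hi j hj hij => ?_,
      fun i hi j hj hij => ?_, fun i hi j hj => hfi i (by omega) j (by omega),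
      fun i hi j hj hij => ?_, fun i hi j hj hne hij => ?_, fun i hi => ?_⟩
    · have := he i (by omega)
      exact mem_star.2 ⟨this.1, by simp [this.2]⟩
    · have := hf i (by omega)
      exact mem_star.2 ⟨this.1, by simp [this.2]⟩
    · rw [hg]
      split_ifs with hiR
      · exact mem_star.2 ⟨(hr i hiR).1, (hr i hiR).2.1⟩
      · have := hf i (by omega)
        exact mem_star.2 ⟨this.1, by simp [this.2]⟩
    · have h1 := (he i (by omega)).2
      rw [hij, (hf j (by omega)).2, Sym2.congr_right] at h1
      exact hyz h1.symm
    · have h1 := (he i (by omega)).2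
      rw [hij, hg] at h1
      split_ifs at h1 with hjR
      · exact (hr j hjR).2.2.1 (by simp [h1])
      · rw [(hf j (by omega)).2, Sym2.congr_right] at h1
        exact hyz h1.symm
    · rw [hg, hg] at hij
      split_ifs at hij with h1 h2 h2
      · exact hri i h1 j h2 hij
      · exact absurd hij (hrf i h1 j hj)
      · exact absurd hij.symm (hrf j h2 i hi)
      · exact hfi i (by omega) j (by omega) hij
    · rw [hg] at hij
      split_ifs at hij with h1
      · exact hrf j h1 i hi hij.symm
      · exact hne (hfi i (by omega) j (by omega) hij)
    · rw [hg]
      split_ifs with hiR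
      · obtain ⟨-, hxr, hyr, hzr⟩ := hr i hiR
        obtain ⟨w, hw⟩ := hxr
        refine ⟨y, z, w, (he i (by omega)).2, (hf i (by omega)).2, hw, hyz, ?_, Or.inl ?_⟩
        · rintro rfl; simp [hw] at hyr
        · rintro rfl; simp [hw] at hzr
      · exact ⟨y, z, z, (he i (by omega)).2, (hf i (by omega)).2, (hf i (by omega)).2, hyz, hyz,
          Or.inr (by omega)⟩
  · refine (card_union_le _ _).trans ((Nat.add_le_add_left (card_union_le _ _) _).trans ?_)
    have h1 : ∀ a : ℕ → E, #((range (l + 1)).image a) ≤ l + 1 := fun a =>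
      card_image_le.trans (card_range _).le
    have := h1 e
    have := h1 f
    have := h1 g
    omega

/-- There are not `3 (l + 1)` edges at a vertex with at most `l + 1` of them parallel, for they
would split into groups of three pairwise nonparallel edges. -/
lemma false_of_spread {S : Finset E} (hx : s ≤ #(star ends F x)) (hS : S ⊆ star ends F x)
    (hcard : #S = 3 * (l + 1)) (hpar : ∀ v, #(S.filter fun e => ends e = s(x, v)) ≤ l + 1) :
    False := by
  obtain ⟨e₀, he₀⟩ := card_pos.1 (by omega : 0 < #S)
  have : Nonempty E := ⟨e₀⟩
  have hother : ∀ e, e ∈ star ends F x → ∃ v, ends e = s(x, v) := fun e he => (mem_star.1 he).2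
  have : Nonempty V := ⟨x⟩
  choose! c hc using hother
  obtain ⟨a, haS, hainj, hane⟩ := exists_spread_enumeration (n := l + 1) c hcard (by
    refine fun v => (card_le_card ?_).trans (hpar v)
    intro e he
    rw [mem_filter] at he ⊢
    exact ⟨he.1, by rw [hc e (hS he.1), he.2]⟩)
  refine h.false_of_isStarFamily hm.le hdel hx (e := a) (f := fun i => a (i + (l + 1)))
    (g := fun i => a (i + 2 * (l + 1))) ?_ ?_
  · refine ⟨fun i hi => hS (haS _ (by omega)), fun i hi => hS (haS _ (by omega)),
      fun i hi => hS (haS _ (by omega)), fun i hi j hj => hainj _ (by omega) _ (by omega),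
      fun i hi j hj hij => ?_, fun i hi j hj hij => ?_, fun i hi j hj hij => ?_,
      fun i hi j hj hij => ?_, fun i hi j hj hne hij => ?_, fun i hi => ?_⟩
    · have := hainj _ (by omega) _ (by omega) hij
      omega
    · have := hainj _ (by omega) _ (by omega) hij
      omega
    · have := hainj _ (by omega) _ (by omega) hij
      omega
    · have := hainj _ (by omega) _ (by omega) hij
      omega
    · have := hainj _ (by omega) _ (by omega) hij
      omega
    · exact ⟨_, _, _, hc _ (hS (haS _ (by omega))), hc _ (hS (haS _ (by omega))),
        hc _ (hS (haS _ (by omega))), hane _ _ (by omega) (by omega),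
        hane _ _ (by omega) (by omega), Or.inl (hane _ _ (by omega) (by omega))⟩
  · refine (card_union_le _ _).trans ((Nat.add_le_add_left (card_union_le _ _) _).trans ?_)
    have h1 : ∀ a : ℕ → E, #((range (l + 1)).image a) ≤ l + 1 := fun a =>
      card_image_le.trans (card_range _).le
    have := h1 a
    have := h1 fun i => a (i + (l + 1))
    have := h1 fun i => a (i + 2 * (l + 1))
    omega

/-- At a vertex of degree at least `s`, almost all edges are parallel. -/
lemma exists_dominant (hx : s ≤ #(star ends F x)) :
    ∃ y, l < #(between ends F x y) ∧ #(away ends F x y) ≤ 2 * l + 1 := by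
  by_contra! hcon
  by_cases hy : ∃ y, l < #(between ends F x y)
  · obtain ⟨y, hy⟩ := hy
    obtain ⟨S₁, hS₁, hS₁c⟩ := exists_subset_card_eq (Nat.succ_le_of_lt hy)
    obtain ⟨S₂, hS₂, hS₂c⟩ := exists_subset_card_eq (Nat.succ_le_of_lt (hcon y hy))
    have hdisj : Disjoint S₁ S₂ := by
      rw [disjoint_left]
      intro e he he'
      have h1 := (mem_between.1 (hS₁ he)).2
      have h2 := (mem_away.1 (hS₂ he')).2.2
      simp [h1] at h2
    refine h.false_of_spread hm hdel hs hx (S := S₁ ∪ S₂) (union_subset (fun e he => ?_)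
      (fun e he => ?_)) ?_ fun v => ?_
    · have := mem_between.1 (hS₁ he)
      exact mem_star.2 ⟨this.1, by simp [this.2]⟩
    · have := mem_away.1 (hS₂ he)
      exact mem_star.2 ⟨this.1, this.2.1⟩
    · rw [card_union_of_disjoint hdisj]
      omega
    · by_cases hv : v = y
      · refine (card_le_card (fun e he => ?_ : _ ⊆ S₁)).trans hS₁c.le
        rw [mem_filter, mem_union] at he
        refine he.1.resolve_right fun he' => (mem_away.1 (hS₂ he')).2.2 ?_
        simp [he.2, hv]
      · have h1 : ¬ l < #(between ends F x v) := fun hlt =>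
          hv (h.eq_of_lt_card_between hm hdel hs hx hlt hy)
        refine (card_le_card (t := between ends F x v) fun e he => ?_).trans (by omega)
        rw [mem_filter, mem_union] at he
        refine mem_between.2 ⟨?_, he.2⟩
        rcases he.1 with he' | he'
        · exact (mem_between.1 (hS₁ he')).1
        · exact (mem_away.1 (hS₂ he')).1
  · push Not at hy
    obtain ⟨S, hS, hSc⟩ := exists_subset_card_eq ((by omega : 3 * (l + 1) ≤ s).trans hx)
    refine h.false_of_spread hm hdel hs hx hS hSc fun v => ?_
    refine (card_le_card (t := between ends F x v) fun e he => ?_).trans ((hy v).trans l.le_succ)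
    rw [mem_filter] at he
    exact mem_between.2 ⟨star_subset (hS he.1), he.2⟩

include hsm

/-- Two vertices meet all edges. The dominant neighbour of a vertex of degree at least `s` has degree
more than `d`, by `lt_card_star_add_away`; as dominance is mutual, all vertices of degree at least `s`
have degree more than `d`. By `card_star_add_away_le` two such vertices are joined by more than `l`
edges, so there are only two of them. Finally, every edge has an end of degree at least `s`. -/
lemma exists_cover : ∃ x y, (∃ e ∈ F, ends e = s(x, y)) ∧
    ∀ e ∈ F, x ∈ ends e ∨ y ∈ ends e := by
  have hbig : ∀ {x}, s ≤ #(star ends F x) → ∃ y, x ≠ y ∧ l < #(between ends F x y) ∧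
      d < #(star ends F y) := by
    intro x hx
    obtain ⟨y, hy, hy'⟩ := h.exists_dominant hm hdel hs hx
    obtain ⟨e, he⟩ := card_pos.1 (Nat.zero_lt_of_lt hy)
    rw [mem_between] at he
    have := h.lt_card_star_add_away he.1 he.2
    exact ⟨y, h.ends_ne he.1 he.2, hy, by omega⟩
  have hedge : ∀ e ∈ F, ∃ v ∈ ends e, s ≤ #(star ends F v) := by
    intro e he
    obtain ⟨u, v, huv⟩ : ∃ u v, ends e = s(u, v) := by
      induction ends e with | _ u v => exact ⟨u, v, rfl⟩
    have h1 := h.lt_card_star_add_away he huv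
    have h2 : #(away ends F u v) < #(star ends F u) := by
      refine card_lt_card (ssubset_iff.2 ⟨e, by simp [huv], insert_subset ?_ ?_⟩)
      · simp [he, huv]
      · intro f hf
        rw [mem_away] at hf
        exact mem_star.2 ⟨hf.1, hf.2.1⟩
    by_cases hu : s ≤ #(star ends F u)
    · exact ⟨u, by simp [huv], hu⟩
    · exact ⟨v, by simp [huv], by omega⟩
  obtain ⟨e₀, he₀⟩ : F.Nonempty := by
    rw [nonempty_iff_ne_empty]
    rintro rfl
    exact h.not_colorable ⟨fun _ => 0, by simp, by simp⟩
  obtain ⟨x, -, hx⟩ := hedge e₀ he₀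
  obtain ⟨y, hxy, hy, hyd⟩ := hbig hx
  have hys : s ≤ #(star ends F y) := by omega
  obtain ⟨g, hg⟩ := card_pos.1 (Nat.zero_lt_of_lt hy)
  rw [mem_between] at hg
  refine ⟨x, y, ⟨g, hg⟩, fun e he => ?_⟩
  obtain ⟨w, hw, hws⟩ := hedge e he
  by_contra! hcon
  have hwx : x ≠ w := by rintro rfl; exact hcon.1 hw
  have hwy : y ≠ w := by rintro rfl; exact hcon.2 hw
  -- Both `w` and its dominant neighbour have degree more than `d`, as has `y`.
  obtain ⟨w', hww', hw', hw'd⟩ := hbig hws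
  have heavy : ∀ {p q}, p ≠ q → d < #(star ends F p) → d < #(star ends F q) →
      l < #(between ends F p q) := by
    intro p q hpq hp hq
    have h1 := card_star_add_away_le hdel (by omega : s ≤ #(star ends F p)) hq
    have h2 := card_star_eq_add (ends := ends) (F := F) hpq
    omega
  have hback : #(between ends F w' w) = #(between ends F w w') := by rw [between_comm]
  have hwd : d < #(star ends F w) := by
    obtain ⟨w'', -, hw'', hw''d⟩ := hbig (by omega : s ≤ #(star ends F w'))
    rwa [← h.eq_of_lt_card_between hm hdel hs (by omega) hw'' (hw'.trans_eq hback.symm)]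
  have hyx : l < #(between ends F y x) := by rwa [between_comm]
  exact hwx (h.eq_of_lt_card_between hm hdel hs hys hyx (heavy hwy hyd hwd))

/-- The deletion of `s ≥ 3 l + 3` pairwise adjacent edges does not always save `s - l - 1` colours.
Otherwise all edges would meet two vertices `x` and `y`. Leaving an edge `xz` with `z ≠ y` uncoloured,
recolouring a single edge `xw` would free a colour for it. -/
lemma false_of_three_mul_le : False := by
  obtain ⟨x, y, ⟨e₁, he₁, he₁'⟩, hcover⟩ := h.exists_cover hm hdel hs hsm
  have hxy := h.ends_ne he₁ he₁'
  obtain ⟨e, he⟩ : (away ends F x y).Nonempty := by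
    rw [← card_pos]
    have := h.lt_card_star_add_away he₁ he₁'
    have := h.card_star_le y
    omega
  obtain ⟨heF, ⟨z, hez⟩, hye⟩ := mem_away.1 he
  have hxz := h.ends_ne heF hez
  have hyz : y ≠ z := by rintro rfl; simp [hez] at hye
  obtain ⟨φ, hφ⟩ := h.colorable_erase e heF
  -- `β` is a colour that is not used on the triangle `xyz`.
  obtain ⟨β, hβm, hβ⟩ : ∃ β < m, ∀ k ∈ F.erase e, φ k = β →
      ends k ≠ s(x, y) ∧ ends k ≠ s(x, z) ∧ ends k ≠ s(y, z) := by
    set T := F.filter fun k => ends k = s(x, y) ∨ ends k = s(x, z) ∨ ends k = s(y, z) with hT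
    have hTm : #T ≤ m := by
      refine h.clique_le T (filter_subset _ _) (isEdgeClique_of_triangle (x := x) (y := y) (z := z) fun p hp => ?_)
      have := (mem_filter.1 hp).2
      tauto
    have heT : e ∈ T := by simp [hT, heF, hez]
    have h1 : #((T.erase e).image φ) < #(range m) := by
      have := card_image_le (s := T.erase e) (f := φ)
      have := card_erase_lt_of_mem heT
      rw [card_range]
      omega
    obtain ⟨β, hβ, hβ'⟩ := exists_mem_notMem_of_card_lt_card h1
    refine ⟨β, mem_range.1 hβ, fun k hk hkβ => ?_⟩
    by_contra hcon
    refine hβ' (mem_image.2 ⟨k, mem_erase.2 ⟨(mem_erase.1 hk).1, ?_⟩, hkβ⟩)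
    rw [hT, mem_filter]
    exact ⟨(mem_erase.1 hk).2, by tauto⟩
  have hβz : β ∈ missing ends (F.erase e) m φ z := by
    refine mem_missing.2 ⟨hβm, fun k hk hzk hkβ => ?_⟩
    rcases hcover k (mem_erase.1 hk).2 with hk' | hk'
    · exact (hβ k hk hkβ).2.1 (ends_eq hxz hk' hzk)
    · exact (hβ k hk hkβ).2.2 (ends_eq hyz hk' hzk)
  obtain ⟨k, hk, hxk, hkβ⟩ : ∃ k ∈ F.erase e, x ∈ ends k ∧ φ k = β := by
    by_contra! hcon
    exact h.not_missing_both heF hez hφ (mem_missing.2 ⟨hβm, hcon⟩) hβz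
  obtain ⟨w, hkw⟩ := hxk
  have hwy : w ≠ y := by rintro rfl; exact (hβ k hk hkβ).1 hkw
  have hwz : w ≠ z := by rintro rfl; exact (hβ k hk hkβ).2.1 hkw
  have hxw := h.ends_ne (mem_erase.1 hk).2 hkw
  -- A colour `γ` missing at `x` is used between `y` and `z`, hence it is missing at `w`.
  obtain ⟨γ, hγ⟩ : (missing ends (F.erase e) m φ x).Nonempty := by
    rw [← card_pos]
    have h1 := le_card_missing_add (ends := ends) (A := F.erase e) (m := m) (φ := φ) (x := x)
    have h2 : #(star ends (F.erase e) x) < #(star ends F x) := by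
      refine card_lt_card (ssubset_iff.2 ⟨e, by simp, insert_subset (by simp [heF, hez]) ?_⟩)
      intro j hj
      rw [mem_star] at hj ⊢
      exact ⟨mem_of_mem_erase hj.1, hj.2⟩
    have := h.card_star_le x
    omega
  obtain ⟨j, hj, hzj, hjγ⟩ : ∃ j ∈ F.erase e, z ∈ ends j ∧ φ j = γ := by
    by_contra! hcon
    exact h.not_missing_both heF hez hφ hγ (mem_missing.2 ⟨(mem_missing.1 hγ).1, hcon⟩)
  rw [mem_missing] at hγ hβz
  have hxj : x ∉ ends j := fun hx => hγ.2 j hj hx hjγ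
  have hyj : y ∈ ends j := (hcover j (mem_erase.1 hj).2).resolve_left hxj
  have hjyz := ends_eq hyz hyj hzj
  have hγw : ∀ i ∈ F.erase e, w ∈ ends i → φ i ≠ γ := by
    intro i hi hwi hiγ
    rcases hcover i (mem_erase.1 hi).2 with hi' | hi'
    · exact hγ.2 i hi hi' hiγ
    · refine hφ.ne i hi j hj ?_ y hi' hyj (hiγ.trans hjγ.symm)
      rintro rfl
      rw [hjyz, Sym2.mem_iff] at hwi
      exact hwi.elim hwy hwz
  have h1 := hφ.update (e := k) hγ.1 (by
    intro i hi _ v hvk hvi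
    rw [hkw, Sym2.mem_iff] at hvk
    rcases hvk with rfl | rfl
    · exact hγ.2 i hi hvi
    · exact hγw i hi hvi)
  rw [insert_eq_of_mem hk] at h1
  refine h.not_colorable ⟨_, insert_erase heF ▸ h1.update (e := e) hβm ?_⟩
  intro i hi hie v hve hvi
  by_cases hik : i = k
  · subst hik
    rw [Function.update_self]
    rintro rfl
    exact hγ.2 i hi (by simp [hkw]) hkβ
  · rw [Function.update_of_ne hik]
    rw [hez, Sym2.mem_iff] at hve
    rcases hve with rfl | rfl
    · rw [← hkβ]
      exact hφ.ne i hi k hk hik v hvi (by simp [hkw])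
    · exact hβz.2 i hi hvi

end Large

end IsCritical

/-! ### Kempe changes and the deletion of two edges -/

/-- In a graph of maximum degree at most two, no component contains three vertices of degree at
most one. -/
lemma not_reachable_of_subsingleton {V : Type*} {H : SimpleGraph V}
    (hdeg : ∀ v a b c, H.Adj v a → H.Adj v b → H.Adj v c → a = b ∨ a = c ∨ b = c) {x y z : V}
    (hxy : x ≠ y) (hxz : x ≠ z) (hyz : y ≠ z)
    (hx : ∀ a b, H.Adj x a → H.Adj x b → a = b) (hy : ∀ a b, H.Adj y a → H.Adj y b → a = b)
    (hz : ∀ a b, H.Adj z a → H.Adj z b → a = b) (h1 : H.Reachable x y) : ¬ H.Reachable x z := by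
  classical
  intro h2
  obtain ⟨p, hp⟩ := h1.exists_isPath
  have hnil : 0 < p.length := by
    rw [Nat.pos_iff_ne_zero]
    exact fun h0 => hxy (SimpleGraph.Walk.eq_of_length_eq_zero h0)
  have hinner : ∀ i, 0 < i → i < p.length →
      H.Adj (p.getVert i) (p.getVert (i - 1)) ∧ H.Adj (p.getVert i) (p.getVert (i + 1)) ∧
        p.getVert (i - 1) ≠ p.getVert (i + 1) := by
    intro i hi hil
    refine ⟨?_, p.adj_getVert_succ hil, fun heq => ?_⟩
    · have := (p.adj_getVert_succ (i := i - 1) (by omega)).symm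
      rwa [Nat.sub_add_cancel hi] at this
    · have := hp.getVert_injOn (show i - 1 ≤ p.length by omega)
        (show i + 1 ≤ p.length by omega) heq
      omega
  -- The vertex set of the path from `x` to `y` is closed under adjacency.
  have hclosed : ∀ u v, H.Adj u v → u ∈ p.support → v ∈ p.support := by
    intro u v huv hu
    obtain ⟨i, rfl, hi⟩ := SimpleGraph.Walk.mem_support_iff_exists_getVert.1 hu
    rcases Nat.eq_zero_or_pos i with rfl | hi0
    · have := p.adj_getVert_succ hnil
      rw [p.getVert_zero] at this huv
      rw [hx _ _ huv this]
      exact p.getVert_mem_support _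
    · rcases hi.lt_or_eq with hil | rfl
      · obtain ⟨ha, hb, hab⟩ := hinner i hi0 hil
        rcases hdeg _ _ _ _ ha hb huv with h | h | h
        · exact absurd h hab
        · rw [← h]; exact p.getVert_mem_support _
        · rw [← h]; exact p.getVert_mem_support _
      · have := (p.adj_getVert_succ (i := p.length - 1) (by omega)).symm
        rw [Nat.sub_add_cancel hnil, p.getVert_length] at this
        rw [p.getVert_length] at huv
        rw [hy _ _ huv this]
        exact p.getVert_mem_support _
  have hzp : z ∈ p.support := by
    obtain ⟨q⟩ := h2
    have : ∀ {u v : V}, H.Walk u v → u ∈ p.support → v ∈ p.support := by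
      intro u v q
      induction q with
      | nil => exact id
      | cons hadj _ ih => exact fun hu => ih (hclosed _ _ hadj hu)
    exact this q p.start_mem_support
  obtain ⟨i, rfl, hi⟩ := SimpleGraph.Walk.mem_support_iff_exists_getVert.1 hzp
  have hi0 : 0 < i := by
    rw [Nat.pos_iff_ne_zero]
    rintro rfl
    exact hxz p.getVert_zero.symm
  have hil : i < p.length := by
    refine hi.lt_of_ne ?_
    rintro rfl
    exact hyz p.getVert_length.symm
  obtain ⟨ha, hb, hab⟩ := hinner i hi0 hil
  exact hab (hz _ _ ha hb)

/-- The graph of the edges in `A` that have colour `α` or `β`. -/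
def kempeGraph (ends : E → Sym2 V) (A : Finset E) (φ : E → ℕ) (α β : ℕ) : SimpleGraph V where
  Adj u v := u ≠ v ∧ ∃ e ∈ A, (φ e = α ∨ φ e = β) ∧ ends e = s(u, v)
  symm := ⟨fun _ _ h => ⟨h.1.symm, h.2.imp fun _ h => ⟨h.1, h.2.1, h.2.2.trans Sym2.eq_swap⟩⟩⟩
  loopless := ⟨fun _ h => h.1 rfl⟩

lemma IsColoring.kempeGraph_adj_eq (h : IsColoring ends A m φ) {e₁ e₂ : E} {u v : V}
    (h₁ : e₁ ∈ A) (h₂ : e₂ ∈ A) (hu : ends e₁ = s(x, u)) (hv : ends e₂ = s(x, v))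
    (hφ : φ e₁ = φ e₂) : u = v := by
  by_contra huv
  refine h.ne e₁ h₁ e₂ h₂ ?_ x (by simp [hu]) (by simp [hv]) hφ
  rintro rfl
  rw [hu, Sym2.congr_right] at hv
  exact huv hv

/-- If `α` is missing at three vertices, then one of them is separated in the Kempe graph from the
other two. -/
lemma IsColoring.kempe_separated (h : IsColoring ends A m φ) {α β : ℕ} (hxy : x ≠ y) (hxz : x ≠ z)
    (hyz : y ≠ z) (hx : α ∈ missing ends A m φ x) (hy : α ∈ missing ends A m φ y)
    (hz : α ∈ missing ends A m φ z) :
    let H := kempeGraph ends A φ α β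
    (¬ H.Reachable x y ∧ ¬ H.Reachable x z) ∨ (¬ H.Reachable y x ∧ ¬ H.Reachable y z) ∨
      (¬ H.Reachable z x ∧ ¬ H.Reachable z y) := by
  intro H
  have hdeg : ∀ v a b c, H.Adj v a → H.Adj v b → H.Adj v c → a = b ∨ a = c ∨ b = c := by
    rintro v a b c ⟨-, e₁, h₁, hc₁, ha⟩ ⟨-, e₂, h₂, hc₂, hb⟩ ⟨-, e₃, h₃, hc₃, hc⟩
    rcases hc₁ with hc₁ | hc₁ <;> rcases hc₂ with hc₂ | hc₂ <;> rcases hc₃ with hc₃ | hc₃ <;>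
      first
      | exact Or.inl (h.kempeGraph_adj_eq h₁ h₂ ha hb (hc₁.trans hc₂.symm))
      | exact Or.inr (Or.inl (h.kempeGraph_adj_eq h₁ h₃ ha hc (hc₁.trans hc₃.symm)))
      | exact Or.inr (Or.inr (h.kempeGraph_adj_eq h₂ h₃ hb hc (hc₂.trans hc₃.symm)))
  have hsub : ∀ {v}, α ∈ missing ends A m φ v → ∀ a b, H.Adj v a → H.Adj v b → a = b := by
    rintro v hv a b ⟨-, e₁, h₁, hc₁, ha⟩ ⟨-, e₂, h₂, hc₂, hb⟩
    have hβ₁ := hc₁.resolve_left ((mem_missing.1 hv).2 e₁ h₁ (by simp [ha]))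
    have hβ₂ := hc₂.resolve_left ((mem_missing.1 hv).2 e₂ h₂ (by simp [hb]))
    exact h.kempeGraph_adj_eq h₁ h₂ ha hb (hβ₁.trans hβ₂.symm)
  by_cases h1 : H.Reachable x y
  · have h2 := not_reachable_of_subsingleton hdeg hxy hxz hyz (hsub hx) (hsub hy) (hsub hz) h1
    exact Or.inr (Or.inr ⟨fun h => h2 h.symm, fun h => h2 (h1.trans h.symm)⟩)
  · by_cases h2 : H.Reachable x z
    · exact Or.inr (Or.inl ⟨fun h => h1 h.symm, fun h => h1 (h2.trans h.symm)⟩)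
    · exact Or.inl ⟨h1, h2⟩

open Classical in
/-- Interchanging `α` and `β` on the component of the Kempe graph that contains `x`. -/
lemma IsColoring.exists_kempe_swap (h : IsColoring ends A m φ) (x : V) {α β : ℕ} (hα : α < m)
    (hβ : β < m) :
    ∃ ψ, IsColoring ends A m ψ ∧
      (∀ k ∈ A, ∀ v ∈ ends k, (kempeGraph ends A φ α β).Reachable x v →
        ψ k = Equiv.swap α β (φ k)) ∧
      (∀ k ∈ A, ∀ v ∈ ends k, ¬ (kempeGraph ends A φ α β).Reachable x v → ψ k = φ k) := by
  set H := kempeGraph ends A φ α β with hH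
  let ψ : E → ℕ := fun k => if ∃ v ∈ ends k, H.Reachable x v then Equiv.swap α β (φ k) else φ k
  have hin : ∀ k ∈ A, ∀ v ∈ ends k, H.Reachable x v → ψ k = Equiv.swap α β (φ k) :=
    fun k _ v hv hr => if_pos ⟨v, hv, hr⟩
  have hout : ∀ k ∈ A, ∀ v ∈ ends k, ¬ H.Reachable x v → ψ k = φ k := by
    intro k hk v hv hr
    by_cases hex : ∃ u ∈ ends k, H.Reachable x u
    · obtain ⟨u, hu, hur⟩ := hex
      have huv : u ≠ v := fun h => hr (h ▸ hur)
      -- An edge that leaves the component has neither of the two colours.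
      have hc : ¬ (φ k = α ∨ φ k = β) := fun hc =>
        hr (hur.trans (SimpleGraph.Adj.reachable ⟨huv, k, hk, hc, ends_eq huv hu hv⟩))
      rw [not_or] at hc
      rw [hin k hk u hu hur, Equiv.swap_apply_of_ne_of_ne hc.1 hc.2]
    · exact if_neg hex
  refine ⟨ψ, ⟨fun k hk => ?_, fun k hk j hj hkj v hvk hvj hψ => ?_⟩, hin, hout⟩
  · by_cases hex : ∃ u ∈ ends k, H.Reachable x u
    · have : ψ k = Equiv.swap α β (φ k) := if_pos hex
      rw [this, Equiv.swap_apply_def]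
      split_ifs
      · exact hβ
      · exact hα
      · exact h.lt k hk
    · have : ψ k = φ k := if_neg hex
      exact this ▸ h.lt k hk
  · by_cases hv : H.Reachable x v
    · rw [hin k hk v hvk hv, hin j hj v hvj hv] at hψ
      exact h.ne k hk j hj hkj v hvk hvj ((Equiv.swap α β).injective hψ)
    · rw [hout k hk v hvk hv, hout j hj v hvj hv] at hψ
      exact h.ne k hk j hj hkj v hvk hvj hψ

/-- Let the edges of a triangle be uncoloured, let `α` be missing at its vertices, and let `x` be
separated from the other two vertices in the Kempe graph. After a Kempe change at `x`, the triangle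
can be coloured with the help of one additional colour. -/
lemma IsColoring.exists_color_triangle (h : IsColoring ends A m φ) (he : ends e = s(x, y))
    (hf : ends f = s(x, z)) (hg : ends g = s(y, z)) (heA : e ∉ A) (hfA : f ∉ A) (hgA : g ∉ A)
    (hxy : x ≠ y) (hxz : x ≠ z) (hyz : y ≠ z) {α β : ℕ} (hαβ : α ≠ β) (hβ : β < m)
    (hx : α ∈ missing ends A m φ x) (hy : α ∈ missing ends A m φ y)
    (hz : α ∈ missing ends A m φ z)
    (hsep : ¬ (kempeGraph ends A φ α β).Reachable x y ∧ ¬ (kempeGraph ends A φ α β).Reachable x z)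
    (hβz : ∀ k ∈ A, z ∈ ends k → φ k = β → x ∉ ends k ∧ y ∉ ends k) :
    Colorable ends (insert e (insert f (insert g A))) (m + 1) := by
  have hα := (mem_missing.1 hx).1
  obtain ⟨ψ, hψ, hin, hout⟩ := h.exists_kempe_swap x hα hβ
  rw [mem_missing] at hx hy hz
  have hβx : ∀ k ∈ A, x ∈ ends k → ψ k ≠ β := fun k hk hxk hkβ => by
    rw [hin k hk x hxk (SimpleGraph.Reachable.refl _), Equiv.swap_apply_eq_iff,
      Equiv.swap_apply_right] at hkβ
    exact hx.2 k hk hxk hkβ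
  have hαy : ∀ k ∈ A, y ∈ ends k → ψ k ≠ α := fun k hk hyk => by
    rw [hout k hk y hyk hsep.1]
    exact hy.2 k hk hyk
  have hαz : ∀ k ∈ A, z ∈ ends k → ψ k ≠ α := fun k hk hzk => by
    rw [hout k hk z hzk hsep.2]
    exact hz.2 k hk hzk
  have hef : e ≠ f := by
    rintro rfl
    rw [he, Sym2.congr_right] at hf
    exact hyz hf
  have hge : g ≠ e := by
    rintro rfl
    have : x ∈ ends g := by simp [he]
    simp [hg, hxy, hxz] at this
  have hgf : g ≠ f := by
    rintro rfl
    have : x ∈ ends g := by simp [hf]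
    simp [hg, hxy, hxz] at this
  -- Colour `g` with `α`; then `f` is alone in the new colour class `m`, and `β` is missing at `x`.
  have h1 := hψ.update (e := g) hα (by
    intro k hk _ v hv hvk
    rw [hg, Sym2.mem_iff] at hv
    rcases hv with rfl | rfl
    · exact hαy k hk hvk
    · exact hαz k hk hvk)
  have h2 := (h1.mono_right m.le_succ).update (e := f) (Nat.lt_succ_self m)
    fun k hk _ v _ _ => (h1.lt k hk).ne
  have hf' : f ∉ insert g A := by simp [hgf.symm, hfA]
  have hval : ∀ k ∈ A, Function.update (Function.update ψ g α) f m k = ψ k := fun k hk => by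
    rw [Function.update_of_ne (fun h : k = f => hfA (h ▸ hk)),
      Function.update_of_ne (fun h : k = g => hgA (h ▸ hk))]
  obtain ⟨χ, hχ, -⟩ := h2.exists_extend (e := e) (f := f) (x := x) (y := y) (z := z) (α := β)
    (by simp [hef, hge.symm, heA]) (mem_insert_self _ _) he hf hyz hxy hxz
    (by
      intro k hk hkf
      rw [Function.update_self] at hkf
      by_contra hne
      rw [Function.update_of_ne hne] at hkf
      exact (h1.lt k ((mem_insert.1 hk).resolve_left hne)).ne hkf)
    (by
      refine mem_missing.2 ⟨hβ.trans m.lt_succ_self, fun k hk hxk => ?_⟩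
      rcases mem_insert.1 hk with rfl | hk
      · rw [Function.update_self]; exact hβ.ne'
      · rcases mem_insert.1 hk with rfl | hk
        · rw [Function.update_of_ne hgf, Function.update_self]; exact hαβ
        · rw [hval k hk]; exact hβx k hk hxk)
    (by
      intro k hk hkyz
      rcases mem_insert.1 hk with rfl | hk
      · rw [Function.update_self]; exact hβ.ne'
      · rcases mem_insert.1 hk with rfl | hk
        · rw [Function.update_of_ne hgf, Function.update_self]; exact hαβ
        · rw [hval k hk, hout k hk z (by simp [hkyz]) hsep.2]
          exact fun hkβ => (hβz k hk (by simp [hkyz]) hkβ).2 (by simp [hkyz]))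
  exact ⟨χ, hχ⟩

namespace IsCritical

/-- Let all edges but `e = xy` and `f = xz` be coloured without using the last colour. Each colour
missing at `x` is used between `y` and `z`, since otherwise `f` could get the last colour and
`IsColoring.exists_extend` would apply. -/
lemma exists_between_of_missing (h : IsCritical ends F (m + 1)) (heF : e ∈ F) (hfF : f ∈ F)
    (he : ends e = s(x, y)) (hf : ends f = s(x, z)) (hyz : y ≠ z)
    (hφ : IsColoring ends (F \ {e, f}) m φ) {α : ℕ} (hα : α ∈ missing ends (F \ {e, f}) m φ x) :
    ∃ g ∈ F \ {e, f}, ends g = s(y, z) ∧ φ g = α := by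
  by_contra! hcon
  have hef : e ≠ f := by
    rintro rfl
    rw [he, Sym2.congr_right] at hf
    exact hyz hf
  have hα' := mem_missing.1 hα
  have h1 := (hφ.mono_right m.le_succ).update (e := f) (Nat.lt_succ_self m)
    fun k hk _ v _ _ => (hφ.lt k hk).ne
  have hfA : f ∉ F \ {e, f} := by simp
  have hval : ∀ k ∈ F \ {e, f}, Function.update φ f m k = φ k := fun k hk =>
    Function.update_of_ne (fun h : k = f => hfA (h ▸ hk)) _ _
  obtain ⟨χ, hχ, -⟩ := h1.exists_extend (e := e) (f := f) (x := x) (y := y) (z := z) (α := α)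
    (by simp [hef]) (mem_insert_self _ _) he hf hyz (h.ends_ne heF he) (h.ends_ne hfF hf)
    (by
      intro k hk hkf
      rw [Function.update_self] at hkf
      by_contra hne
      rw [Function.update_of_ne hne] at hkf
      exact (hφ.lt k ((mem_insert.1 hk).resolve_left hne)).ne hkf)
    (by
      refine mem_missing.2 ⟨hα'.1.trans m.lt_succ_self, fun k hk hxk => ?_⟩
      rcases mem_insert.1 hk with rfl | hk
      · rw [Function.update_self]; exact hα'.1.ne'
      · rw [hval k hk]; exact hα'.2 k hk hxk)
    (by
      intro k hk hkyz
      rcases mem_insert.1 hk with rfl | hk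
      · rw [Function.update_self]; exact hα'.1.ne'
      · rw [hval k hk]; exact hcon k hk hkyz)
  refine h.not_colorable ⟨χ, ?_⟩
  convert hχ using 1
  ext k
  by_cases hke : k = e
  · simp [hke, heF]
  · by_cases hkf : k = f
    · simp [hkf, hfF]
    · simp [hke, hkf]

/-- The deletion of two adjacent edges does not save two colours. -/
lemma false_of_colorable_sdiff_pair (h : IsCritical ends F (m + 1)) (hm : 1 ≤ m)
    (hdel : ∀ Q ⊆ F, IsEdgeClique ends Q → #Q = 2 → Colorable ends (F \ Q) m) : False := by
  obtain ⟨e, heF⟩ : F.Nonempty := by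
    rw [nonempty_iff_ne_empty]
    rintro rfl
    exact h.not_colorable ⟨fun _ => 0, by simp, by simp⟩
  obtain ⟨x, y, he⟩ : ∃ x y, ends e = s(x, y) := by
    induction ends e with | _ u v => exact ⟨u, v, rfl⟩
  have hxy := h.ends_ne heF he
  obtain ⟨f, hf⟩ : (away ends F x y).Nonempty := by
    rw [← card_pos]
    have := h.lt_card_star_add_away heF he
    have := h.card_star_le y
    omega
  obtain ⟨hfF, ⟨z, hfz⟩, hyf⟩ := mem_away.1 hf
  have hxz := h.ends_ne hfF hfz
  have hyz : y ≠ z := by rintro rfl; simp [hfz] at hyf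
  have hef : e ≠ f := by
    rintro rfl
    rw [he, Sym2.congr_right] at hfz
    exact hyz hfz
  have hpair : ({e, f} : Finset E) ⊆ F := by
    intro k hk
    rw [mem_insert, mem_singleton] at hk
    rcases hk with rfl | rfl
    · exact heF
    · exact hfF
  obtain ⟨φ, hφ⟩ := hdel {e, f} hpair (isEdgeClique_of_mem (x := x) (by simp [he, hfz]))
    (card_pair hef)
  have hcard : ∀ {T : Finset E}, e ∈ T → f ∈ T → #T ≤ m + 1 → #(T \ {e, f}) < m := by
    intro T he hf hT
    have h1 : ({e, f} : Finset E) ⊆ T := by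
      intro k hk
      rw [mem_insert, mem_singleton] at hk
      rcases hk with rfl | rfl
      · exact he
      · exact hf
    rw [card_sdiff_of_subset h1, card_pair hef]
    omega
  obtain ⟨α, hα⟩ : (missing ends (F \ {e, f}) m φ x).Nonempty := by
    rw [← card_pos]
    have h1 := le_card_missing_add (ends := ends) (A := F \ {e, f}) (m := m) (φ := φ) (x := x)
    have h2 : star ends (F \ {e, f}) x = star ends F x \ {e, f} := by
      ext k; simp only [mem_star, mem_sdiff]; tauto
    have h3 := hcard (T := star ends F x) (by simp [heF, he]) (by simp [hfF, hfz])
      (h.card_star_le x)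
    rw [h2] at h1
    omega
  obtain ⟨g, hg, hgyz, hgα⟩ := h.exists_between_of_missing heF hfF he hfz hyz hφ hα
  -- `β` is a colour that is not used on the triangle `xyz`.
  obtain ⟨β, hβm, hβ⟩ : ∃ β < m, ∀ k ∈ F \ {e, f}, φ k = β →
      ends k ≠ s(x, y) ∧ ends k ≠ s(x, z) ∧ ends k ≠ s(y, z) := by
    set T := F.filter fun k => ends k = s(x, y) ∨ ends k = s(x, z) ∨ ends k = s(y, z) with hT
    have hTm : #T ≤ m + 1 := by
      refine h.clique_le T (filter_subset _ _) (isEdgeClique_of_triangle (x := x) (y := y) (z := z) fun p hp => ?_)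
      have := (mem_filter.1 hp).2
      tauto
    have h1 : #((T \ {e, f}).image φ) < #(range m) := by
      rw [card_range]
      exact card_image_le.trans_lt (hcard (by simp [hT, heF, he]) (by simp [hT, hfF, hfz]) hTm)
    obtain ⟨β, hβ, hβ'⟩ := exists_mem_notMem_of_card_lt_card h1
    refine ⟨β, mem_range.1 hβ, fun k hk hkβ => ?_⟩
    by_contra hcon
    refine hβ' (mem_image.2 ⟨k, mem_sdiff.2 ⟨?_, (mem_sdiff.1 hk).2⟩, hkβ⟩)
    rw [hT, mem_filter]
    exact ⟨(mem_sdiff.1 hk).1, by tauto⟩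
  have hαβ : α ≠ β := by
    rintro rfl
    exact (hβ g hg hgα).2.2 hgyz
  -- The edges of the triangle, uncoloured from now on.
  set A := (F \ {e, f}).erase g with hA
  have hgF := (mem_sdiff.1 hg).1
  have hAF : A ⊆ F \ {e, f} := erase_subset _ _
  have hall : insert e (insert f (insert g A)) = F := by
    rw [hA, insert_erase hg]
    ext k
    by_cases hke : k = e
    · simp [hke, heF]
    · by_cases hkf : k = f
      · simp [hkf, hfF]
      · simp [hke, hkf]
  have hφA := hφ.mono hAF
  have heA : e ∉ A := fun hc => by simpa using hAF hc
  have hfA : f ∉ A := fun hc => by simpa using hAF hc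
  have hgA : g ∉ A := notMem_erase _ _
  have hαm := (mem_missing.1 hα).1
  have hαx : α ∈ missing ends A m φ x :=
    mem_missing.2 ⟨hαm, fun j hj => (mem_missing.1 hα).2 j (hAF hj)⟩
  have hαg : ∀ v ∈ ends g, α ∈ missing ends A m φ v := fun v hv =>
    mem_missing.2 ⟨hαm, fun j hj hvj hjα =>
      hφ.ne j (hAF hj) g hg (mem_erase.1 hj).1 v hvj hv (hjα.trans hgα.symm)⟩
  have hαy := hαg y (by simp [hgyz])
  have hαz := hαg z (by simp [hgyz])
  have hβA : ∀ j ∈ A, φ j = β → ends j ≠ s(x, y) ∧ ends j ≠ s(x, z) ∧ ends j ≠ s(y, z) :=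
    fun j hj => hβ j (hAF hj)
  rcases hφA.kempe_separated (β := β) hxy hxz hyz hαx hαy hαz with hsep | hsep | hsep
  · refine h.not_colorable (hall ▸ hφA.exists_color_triangle he hfz hgyz heA hfA hgA hxy hxz hyz
      hαβ hβm hαx hαy hαz hsep fun j hj hzj hjβ => ⟨fun hxj => ?_, fun hyj => ?_⟩)
    · exact (hβA j hj hjβ).2.1 (ends_eq hxz hxj hzj)
    · exact (hβA j hj hjβ).2.2 (ends_eq hyz hyj hzj)
  · have hall' : insert e (insert g (insert f A)) = F := by rw [insert_comm g f]; exact hall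
    refine h.not_colorable (hall' ▸ hφA.exists_color_triangle (he.trans Sym2.eq_swap) hgyz hfz
      heA hgA hfA hxy.symm hyz hxz hαβ hβm hαy hαx hαz hsep
      fun j hj hzj hjβ => ⟨fun hyj => ?_, fun hxj => ?_⟩)
    · exact (hβA j hj hjβ).2.2 (ends_eq hyz hyj hzj)
    · exact (hβA j hj hjβ).2.1 (ends_eq hxz hxj hzj)
  · have hall' : insert f (insert g (insert e A)) = F := by
      rw [insert_comm g e, insert_comm f e, hall]
    refine h.not_colorable (hall' ▸ hφA.exists_color_triangle (hfz.trans Sym2.eq_swap)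
      (hgyz.trans Sym2.eq_swap) he hfA hgA heA hxz.symm hyz.symm hxy hαβ hβm hαz hαx hαy hsep
      fun j hj hyj hjβ => ⟨fun hzj => ?_, fun hxj => ?_⟩)
    · exact (hβA j hj hjβ).2.2 (ends_eq hyz hyj hzj)
    · exact (hβA j hj hjβ).1 (ends_eq hxy hxj hyj)

end IsCritical

/-! ### The line graph of a multigraph -/

/-- The statement for edge sets of multigraphs given by the end map. -/
lemma exists_clique_not_colorable {V E : Type*} [DecidableEq V] [DecidableEq E]
    {ends : E → Sym2 V} {F : Finset E} {s t l : ℕ} (hs : 7 * l + 4 ≤ 2 * s) (hst : s ≤ t)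
    (hF : ¬ Colorable ends F (s + t - 2))
    (hclique : ∀ Q ⊆ F, IsEdgeClique ends Q → #Q ≤ s + t - 2) :
    ∃ Q ⊆ F, IsEdgeClique ends Q ∧ #Q = s ∧ ¬ Colorable ends (F \ Q) (t + l - 1) := by
  by_contra! hcon
  obtain ⟨F', hF', hmin⟩ := exists_minimal_le_of_wellFoundedLT
    (fun A : Finset E => ¬ Colorable ends A (s + t - 2)) F hF
  have hcrit : IsCritical ends F' (s + t - 2) := by
    refine ⟨hmin.prop, fun e he => ?_, fun Q hQ => hclique Q (hQ.trans hF')⟩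
    by_contra hne
    exact hmin.not_prop_of_lt (erase_ssubset he) hne
  have hdel : ∀ Q ⊆ F', IsEdgeClique ends Q → #Q = s → Colorable ends (F' \ Q) (t + l - 1) := by
    intro Q hQ hQc hQs
    obtain ⟨φ, hφ⟩ := hcon Q (hQ.trans hF') hQc hQs
    exact ⟨φ, hφ.mono (sdiff_subset_sdiff hF' le_rfl)⟩
  by_cases h3 : 3 * l + 3 ≤ s
  · exact hcrit.false_of_three_mul_le (by omega) hdel h3 (by omega)
  · obtain rfl : l = 0 := by omega
    obtain rfl : s = 2 := by omega
    have h1 : 2 + t - 2 = t - 1 + 1 := by omega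
    rw [h1] at hcrit
    exact hcrit.false_of_colorable_sdiff_pair (by omega) hdel

end EdgeColoring

namespace Graph

variable {α β : Type*} (G : Graph α β)

/-- The two ends of an edge, as an unordered pair. -/
noncomputable def edgeEnds (e : G.edgeSet) : Sym2 α :=
  s((G.exists_isLink_of_mem_edgeSet e.2).choose,
    (G.exists_isLink_of_mem_edgeSet e.2).choose_spec.choose)

lemma mem_edgeEnds {e : G.edgeSet} {x : α} : x ∈ G.edgeEnds e ↔ G.Inc e x := by
  have h := (G.exists_isLink_of_mem_edgeSet e.2).choose_spec.choose_spec
  rw [edgeEnds, Sym2.mem_iff]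
  constructor
  · rintro (rfl | rfl)
    · exact h.inc_left
    · exact h.inc_right
  · exact fun hx => hx.eq_or_eq_of_isLink h

lemma isClique_lineGraph_iff {Q : Finset G.edgeSet} :
    G.lineGraph.IsClique (Q : Set G.edgeSet) ↔ EdgeColoring.IsEdgeClique G.edgeEnds Q := by
  constructor
  · intro h e he f hf
    by_cases hef : e = f
    · subst hef
      exact ⟨_, Sym2.out_fst_mem _, Sym2.out_fst_mem _⟩
    · obtain ⟨-, x, hx, hx'⟩ := h he hf hef
      exact ⟨x, G.mem_edgeEnds.2 hx, G.mem_edgeEnds.2 hx'⟩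
  · intro h e he f hf hef
    obtain ⟨x, hx, hx'⟩ := h e he f hf
    exact ⟨hef, x, G.mem_edgeEnds.1 hx, G.mem_edgeEnds.1 hx'⟩

lemma colorable_induce_lineGraph_iff {A : Finset G.edgeSet} {n : ℕ} :
    (G.lineGraph.induce (A : Set G.edgeSet)).Colorable n ↔
      EdgeColoring.Colorable G.edgeEnds A n := by
  classical
  constructor
  · rintro ⟨C⟩
    refine ⟨fun e => if he : e ∈ A then C ⟨e, he⟩ else 0, fun e he => ?_,
      fun e he f hf hef v hve hvf heq => ?_⟩
    · simp [he]
    · simp only [he, hf, dif_pos] at heq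
      refine C.valid (v := ⟨e, he⟩) (w := ⟨f, hf⟩) ?_ (Fin.ext heq)
      exact ⟨hef, v, G.mem_edgeEnds.1 hve, G.mem_edgeEnds.1 hvf⟩
  · rintro ⟨φ, hφ⟩
    refine ⟨SimpleGraph.Coloring.mk (fun e => ⟨φ e, hφ.lt e e.2⟩) ?_⟩
    rintro ⟨e, he⟩ ⟨f, hf⟩ ⟨hef, v, hve, hvf⟩ heq
    exact hφ.ne e he f hf hef v (G.mem_edgeEnds.2 hve) (G.mem_edgeEnds.2 hvf)
      (congrArg Fin.val heq)

end Graph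

theorem theorem1 {α β : Type*} (G : Graph α β) (hG : G.edgeSet.Finite) (s t l : ℕ)
    (hs : (7 / 2 : ℚ) * (l : ℚ) + 2 ≤ (s : ℚ)) (hst : s ≤ t)
    (hchi : G.lineGraph.chromaticNumber = ((s + t - 1 : ℕ) : ℕ∞))
    (homega : G.lineGraph.cliqueNum < s + t - 1) :
    ∃ Q : Finset G.edgeSet, G.lineGraph.IsNClique s Q ∧
      ((t + l : ℕ) : ℕ∞) ≤
        (G.lineGraph.induce ((Q : Set G.edgeSet)ᶜ)).chromaticNumber := by
  classical
  have : Fintype G.edgeSet := hG.fintype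
  have hs' : 7 * l + 4 ≤ 2 * s := by
    have : (7 * l + 4 : ℚ) ≤ 2 * s := by linarith
    exact_mod_cast this
  have hF : ¬ EdgeColoring.Colorable G.edgeEnds Finset.univ (s + t - 2) := by
    rw [← G.colorable_induce_lineGraph_iff, Finset.coe_univ]
    intro hcol
    have hcol' : G.lineGraph.Colorable (s + t - 2) :=
      hcol.of_hom (SimpleGraph.induceUnivIso G.lineGraph).symm.toHom
    have h1 := hcol'.chromaticNumber_le
    rw [hchi, Nat.cast_le] at h1
    omega
  obtain ⟨Q, -, hQ, hQs, hQcol⟩ := EdgeColoring.exists_clique_not_colorable hs' hst hF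
    fun Q _ hQ => by
      have := (G.isClique_lineGraph_iff.2 hQ).card_le_cliqueNum
      omega
  refine ⟨Q, ⟨G.isClique_lineGraph_iff.2 hQ, hQs⟩, ?_⟩
  by_contra! hlt
  rw [← G.colorable_induce_lineGraph_iff, Finset.coe_sdiff, Finset.coe_univ,
    ← Set.compl_eq_univ_sdiff] at hQcol
  refine hQcol (SimpleGraph.chromaticNumber_le_iff_colorable.1 (Order.le_of_lt_add_one ?_))
  have h1 : t + l = t + l - 1 + 1 := by omega
  rw [h1] at hlt
  exact_mod_cast hlt
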